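/- Let $\Gamma$ be a finite simplicial graph (no loops, no multiple edges) with vertex set $V$. Let $A_\Gamma=\langle V \mid vwv^{-1}w^{-1}=1 \text{ for adjacent } v,w\rangle$ be its right-angled Artin group. For $\Delta\subseteq V$ let $A_\Delta=\langle\Delta\rangle\le A_\Gamma$ be the corresponding special subgroup, which is called proper if $\Delta\neq V$. Write $\operatorname{lk}(v)$ for the set of neighbours of $v$, $\operatorname{st}(v)=\{v\}\cup\operatorname{lk}(v)$, and $v\le w$ if $\operatorname{lk}(v)\subseteq\operatorname{st}(w)$. Let $\operatorname{Out}^0(A_\Gamma)\le\operatorname{Out}(A_\Gamma)$ be the subgroup generated by the classes of all inversions ($v\mapsto v^{-1}$, other vertices fixed), all transvections ($v\mapsto vw$ for vertices $v\ne w$ with $v\le w$, other vertices fixed) and all partial conjugations ($u\mapsto vuv^{-1}$ for $u\in K$, other vertices fixed, where $K$ is a union of connected components of $\Gamma\setminus\operatorname{st}(v)$). An outer automorphism $\Phi$ stabilises a subgroup $H$ if some representative $\varphi$ of $\Phi$ satisfies $\varphi(H)=H$, and acts trivially on $H$ if some representative restricts to the identity on $H$. Let $\mathcal G,\mathcal H$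 be families of special subgroups of $A_\Gamma$, and let $O=\operatorname{Out}^0(A_\Gamma;\mathcal G,\mathcal H^t)$ be the group of all elements of $\operatorname{Out}^0(A_\Gamma)$ that stabilise every member of $\mathcal G$ and act trivially on every member of $\mathcal H$. Assume that $\mathcal G$ is saturated with respect to $(\mathcal G,\mathcal H)$, i.e. it contains every proper special subgroup that is stabilised by all elements of $O$. Write $v\le_{\mathcal G}w$ if $v\le w$ and every $A_\Delta\in\mathcal G$ with $v\in\Delta$ satisfies $w\in\Delta$; write $v\sim_{\mathcal G}w$ if $v\le_{\mathcal G}w$ and $w\le_{\mathcal G}v$, let $[v]_{\mathcal G}$ be the equivalence class of $v$, and let $T_{\mathcal G}$ be the set of these classes. The rank of $O$ is $$\operatorname{rk}(O)=\sum_{[v]_{\mathcal G}\in T_{\mathcal G}}\bigl(|[v]_{\mathcal G}|-1\bigr).$$ Then: 1. The natural homomorphism $\operatorname{Aut}(\Gamma)\to\operatorname{Out}(A_\Gamma)$, given by permuting the generators, is injective. Identify $\operatorname{Aut}(\Gamma)$ with its image and put $\operatorname{Aut}^0(\Gamma)=\operatorname{Aut}(\Gamma)\cap O$. 2. $\operatorname{Aut}^0(\Gamma)$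 is naturally isomorphic to $\prod_{[v]_{\mathcal G}\in T_{\mathcal G}}\operatorname{Sym}([v]_{\mathcal G})$: there is a group isomorphism from this direct product to $\operatorname{Aut}^0(\Gamma)$ that sends a family $(p_c)_{c\in T_{\mathcal G}}$ to the graph automorphism acting on each class $c$ as $p_c$. 3. There is a finite subset $S\subset\operatorname{Aut}^0(\Gamma)\le O$ such that $(\operatorname{Aut}^0(\Gamma),S)$ is a Coxeter system of rank $|S|=\operatorname{rk}(O)$. -/

import Mathlib

/-! ### Outer automorphism groups and relative outer automorphism groups -/

instance MulAut.conj_range_normal (A : Type*) [Group A] :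
    (MulAut.conj : A →* MulAut A).range.Normal where
  conj_mem := by
    rintro _ ⟨a, rfl⟩ φ
    refine ⟨φ a, ?_⟩
    ext x
    simp [MulAut.conj_apply]

/-- The outer automorphism group `Out(A) = Aut(A) / Inn(A)`. -/
abbrev OutAut (A : Type*) [Group A] : Type _ :=
  MulAut A ⧸ (MulAut.conj : A →* MulAut A).range

namespace OutAut

variable {A : Type*} [Group A]

/-- The outer automorphism `Φ` stabilises the subgroup `H`: some representative `φ` of `Φ`
satisfies `φ(H) = H`. -/
def Stabilises (Φ : OutAut A) (H : Subgroup A) : Prop :=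
  ∃ φ : MulAut A, (φ : OutAut A) = Φ ∧ H.map φ.toMonoidHom = H

/-- The outer automorphism `Φ` acts trivially on the subgroup `H`: some representative of `Φ`
restricts to the identity on `H`. -/
def ActsTrivially (Φ : OutAut A) (H : Subgroup A) : Prop :=
  ∃ φ : MulAut A, (φ : OutAut A) = Φ ∧ ∀ h ∈ H, φ h = h

theorem Stabilises.one (H : Subgroup A) : (1 : OutAut A).Stabilises H :=
  ⟨1, rfl, by ext x; simp [Subgroup.mem_map]⟩

theorem Stabilises.mul {Φ Ψ : OutAut A} {H : Subgroup A} (h : Φ.Stabilises H)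
    (h' : Ψ.Stabilises H) : (Φ * Ψ).Stabilises H := by
  obtain ⟨φ, rfl, hφ⟩ := h
  obtain ⟨ψ, rfl, hψ⟩ := h'
  refine ⟨φ * ψ, rfl, ?_⟩
  have e : (φ * ψ).toMonoidHom = φ.toMonoidHom.comp ψ.toMonoidHom := rfl
  rw [e, ← Subgroup.map_map, hψ, hφ]

theorem Stabilises.inv {Φ : OutAut A} {H : Subgroup A} (h : Φ.Stabilises H) :
    (Φ⁻¹).Stabilises H := by
  obtain ⟨φ, rfl, hφ⟩ := h
  refine ⟨φ⁻¹, rfl, ?_⟩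
  have e : (φ⁻¹).toMonoidHom.comp φ.toMonoidHom = MonoidHom.id A := by
    ext x
    exact φ.symm_apply_apply x
  conv_lhs => rw [← hφ]
  rw [Subgroup.map_map, e, Subgroup.map_id]

theorem ActsTrivially.one (H : Subgroup A) : (1 : OutAut A).ActsTrivially H :=
  ⟨1, rfl, fun _ _ => rfl⟩

theorem ActsTrivially.mul {Φ Ψ : OutAut A} {H : Subgroup A} (h : Φ.ActsTrivially H)
    (h' : Ψ.ActsTrivially H) : (Φ * Ψ).ActsTrivially H := by
  obtain ⟨φ, rfl, hφ⟩ := h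
  obtain ⟨ψ, rfl, hψ⟩ := h'
  refine ⟨φ * ψ, rfl, fun x hx => ?_⟩
  rw [MulAut.mul_apply, hψ x hx, hφ x hx]

theorem ActsTrivially.inv {Φ : OutAut A} {H : Subgroup A} (h : Φ.ActsTrivially H) :
    (Φ⁻¹).ActsTrivially H := by
  obtain ⟨φ, rfl, hφ⟩ := h
  refine ⟨φ⁻¹, rfl, fun x hx => ?_⟩
  conv_lhs => rw [← hφ x hx]
  exact φ.symm_apply_apply x

/-- The relative outer automorphism group `Out(A; 𝒢, ℋᵗ)`: all outer automorphisms that stabilise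
every member of `𝒢` and act trivially on every member of `ℋ`. -/
def relative (𝒢 ℋ : Set (Subgroup A)) : Subgroup (OutAut A) where
  carrier := {Φ | (∀ H ∈ 𝒢, Φ.Stabilises H) ∧ ∀ H ∈ ℋ, Φ.ActsTrivially H}
  one_mem' := ⟨fun H _ => Stabilises.one H, fun H _ => ActsTrivially.one H⟩
  mul_mem' h h' :=
    ⟨fun H hH => (h.1 H hH).mul (h'.1 H hH), fun H hH => (h.2 H hH).mul (h'.2 H hH)⟩
  inv_mem' h := ⟨fun H hH => (h.1 H hH).inv, fun H hH => (h.2 H hH).inv⟩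

end OutAut

/-! ### Right-angled Artin groups -/

/-- The right-angled Artin group `A_Γ`: generators are the vertices of `Γ`, and adjacent vertices
commute. -/
abbrev RAAG {V : Type*} (Γ : SimpleGraph V) : Type _ :=
  PresentedGroup {r : FreeGroup V | ∃ v w, Γ.Adj v w ∧
    r = FreeGroup.of v * FreeGroup.of w * (FreeGroup.of v)⁻¹ * (FreeGroup.of w)⁻¹}

namespace RAAG

variable {V : Type*} (Γ : SimpleGraph V)

/-- The generator of `A_Γ` given by a vertex. -/
abbrev gen (v : V) : RAAG Γ := PresentedGroup.of v

/-- The special subgroup `A_Δ ≤ A_Γ` of the full subgraph with vertex set `Δ`. -/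
def special (Δ : Set V) : Subgroup (RAAG Γ) := Subgroup.closure (gen Γ '' Δ)

/-- The star of a vertex: the vertex together with its link `Γ.neighborSet v`. -/
def starSet (v : V) : Set V := insert v (Γ.neighborSet v)

variable {Γ} in
/-- The endomorphism of `A_Γ` that a graph automorphism induces by permuting the generators. -/
def mapHom (σ : Γ ≃g Γ) : RAAG Γ →* RAAG Γ :=
  PresentedGroup.toGroup (f := fun v => gen Γ (σ v)) (by
    rintro _ ⟨v, w, hvw, rfl⟩
    simp only [map_mul, map_inv, FreeGroup.lift_apply_of]
    exact PresentedGroup.one_of_mem (rels := {r : FreeGroup V | ∃ v w, Γ.Adj v w ∧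
      r = FreeGroup.of v * FreeGroup.of w * (FreeGroup.of v)⁻¹ * (FreeGroup.of w)⁻¹})
      ⟨σ v, σ w, σ.map_rel_iff.2 hvw, rfl⟩)

variable {Γ} in
theorem mapHom_gen (σ : Γ ≃g Γ) (v : V) : mapHom σ (gen Γ v) = gen Γ (σ v) :=
  PresentedGroup.toGroup.of _

variable {Γ} in
theorem mapHom_mul (σ τ : Γ ≃g Γ) : mapHom (σ * τ) = (mapHom σ).comp (mapHom τ) :=
  PresentedGroup.ext fun v => by
    change mapHom (σ * τ) (gen Γ v) = mapHom σ (mapHom τ (gen Γ v))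
    rw [mapHom_gen, mapHom_gen, mapHom_gen]
    rfl

theorem mapHom_one : mapHom (1 : Γ ≃g Γ) = MonoidHom.id _ :=
  PresentedGroup.ext fun v => mapHom_gen 1 v

/-- The homomorphism `Aut(Γ) → Aut(A_Γ)`, where a graph automorphism permutes the generators. -/
def graphAut : (Γ ≃g Γ) →* MulAut (RAAG Γ) where
  toFun σ := MonoidHom.toMulEquiv (mapHom σ) (mapHom σ⁻¹)
    (by rw [← mapHom_mul, inv_mul_cancel, mapHom_one])
    (by rw [← mapHom_mul, mul_inv_cancel, mapHom_one])
  map_one' := by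
    ext x
    exact DFunLike.congr_fun (mapHom_one Γ) x
  map_mul' σ τ := by
    ext x
    exact DFunLike.congr_fun (mapHom_mul σ τ) x

theorem graphAut_gen (σ : Γ ≃g Γ) (v : V) : graphAut Γ σ (gen Γ v) = gen Γ (σ v) :=
  mapHom_gen σ v

/-- The natural homomorphism `Aut(Γ) → Out(A_Γ)`. -/
def graphOut : (Γ ≃g Γ) →* OutAut (RAAG Γ) :=
  (QuotientGroup.mk' _).comp (graphAut Γ)

/-- `φ` is the inversion at `v`. -/
def IsInversion (v : V) (φ : MulAut (RAAG Γ)) : Prop :=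
  φ (gen Γ v) = (gen Γ v)⁻¹ ∧ ∀ u, u ≠ v → φ (gen Γ u) = gen Γ u

/-- `φ` is the transvection sending `v` to `v w`, where `v ≠ w` and `v ≤ w` in the standard
ordering, i.e. the link of `v` is contained in the star of `w`. -/
def IsTransvection (v w : V) (φ : MulAut (RAAG Γ)) : Prop :=
  v ≠ w ∧ Γ.neighborSet v ⊆ starSet Γ w ∧
    φ (gen Γ v) = gen Γ v * gen Γ w ∧ ∀ u, u ≠ v → φ (gen Γ u) = gen Γ u

/-- `φ` is the partial conjugation by `v` of a union `K` of connected components of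
`Γ ∖ star(v)`. -/
def IsPartialConj (v : V) (K : Set V) (φ : MulAut (RAAG Γ)) : Prop :=
  (∃ 𝒞 : Set (Γ.induce (starSet Γ v)ᶜ).ConnectedComponent,
      K = ⋃ C ∈ 𝒞, Subtype.val '' C.supp) ∧
    (∀ u ∈ K, φ (gen Γ u) = gen Γ v * gen Γ u * (gen Γ v)⁻¹) ∧
    ∀ u, u ∉ K → φ (gen Γ u) = gen Γ u

/-- The pure outer automorphism group `Out⁰(A_Γ)`, generated by all inversions, transvections and
partial conjugations. -/
def outZero : Subgroup (OutAut (RAAG Γ)) :=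
  Subgroup.closure {Φ | ∃ φ : MulAut (RAAG Γ), (φ : OutAut (RAAG Γ)) = Φ ∧
    ((∃ v, IsInversion Γ v φ) ∨ (∃ v w, IsTransvection Γ v w φ) ∨ ∃ v K, IsPartialConj Γ v K φ)}

/-- The group `Out⁰(A_Γ; 𝒢, ℋᵗ) = Out(A_Γ; 𝒢, ℋᵗ) ∩ Out⁰(A_Γ)`. Families of special subgroups are
given by the vertex sets of the corresponding full subgraphs. -/
def relOutZero (𝒢 ℋ : Set (Set V)) : Subgroup (OutAut (RAAG Γ)) :=
  OutAut.relative (special Γ '' 𝒢) (special Γ '' ℋ) ⊓ outZero Γ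

/-- `𝒢` is saturated with respect to `(𝒢, ℋ)`: it contains every proper special subgroup that is
stabilised by `Out⁰(A_Γ; 𝒢, ℋᵗ)`. -/
def IsSaturated (𝒢 ℋ : Set (Set V)) : Prop :=
  ∀ Δ : Set V, Δ ≠ Set.univ →
    (∀ Φ ∈ relOutZero Γ 𝒢 ℋ, Φ.Stabilises (special Γ Δ)) → Δ ∈ 𝒢

/-- The `𝒢`-ordering: `v ≤ w` in the standard ordering, and every member of `𝒢` that contains `v`
also contains `w`. -/
def OrdLE (𝒢 : Set (Set V)) (v w : V) : Prop :=
  Γ.neighborSet v ⊆ starSet Γ w ∧ ∀ Δ ∈ 𝒢, v ∈ Δ → w ∈ Δ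

theorem OrdLE.refl (𝒢 : Set (Set V)) (v : V) : OrdLE Γ 𝒢 v v :=
  ⟨Set.subset_insert _ _, fun _ _ h => h⟩

variable {Γ} in
theorem OrdLE.trans {𝒢 : Set (Set V)} {u v w : V} (h : OrdLE Γ 𝒢 u v) (h' : OrdLE Γ 𝒢 v w) :
    OrdLE Γ 𝒢 u w := by
  refine ⟨fun x hx => ?_, fun Δ hΔ hu => h'.2 Δ hΔ (h.2 Δ hΔ hu)⟩
  have key : ∀ {a b : V}, OrdLE Γ 𝒢 a b → ∀ y, Γ.Adj a y → y = b ∨ Γ.Adj b y :=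
    fun hab y hy => hab.1 hy
  change x = w ∨ Γ.Adj w x
  rcases key h x hx with rfl | hvx
  · rcases key h' u hx.symm with rfl | hwu
    · exact Or.inr hx
    · rcases key h w hwu.symm with rfl | hvw
      · exact Or.inl rfl
      · exact Or.inr hvw.symm
  · exact key h' x hvx

/-- The equivalence relation `∼_𝒢` of the `𝒢`-ordering. -/
def ordSetoid (𝒢 : Set (Set V)) : Setoid V where
  r v w := OrdLE Γ 𝒢 v w ∧ OrdLE Γ 𝒢 w v
  iseqv :=
    { refl := fun v => ⟨OrdLE.refl Γ 𝒢 v, OrdLE.refl Γ 𝒢 v⟩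
      symm := fun h => ⟨h.2, h.1⟩
      trans := fun h h' => ⟨h.1.trans h'.1, h'.2.trans h.2⟩ }

/-- The set `T_𝒢` of `∼_𝒢`-equivalence classes. -/
abbrev OrdClass (𝒢 : Set (Set V)) : Type _ := Quotient (ordSetoid Γ 𝒢)

/-- The class of a vertex in `T_𝒢`. -/
abbrev cls (𝒢 : Set (Set V)) (v : V) : OrdClass Γ 𝒢 := Quotient.mk (ordSetoid Γ 𝒢) v

/-- The elements of an equivalence class. -/
abbrev ClassElems (𝒢 : Set (Set V)) (c : OrdClass Γ 𝒢) : Type _ := {v : V // cls Γ 𝒢 v = c}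

/-- The rank `rk(O) = ∑_{[v] ∈ T_𝒢} (|[v]| - 1)` of `O = Out⁰(A_Γ; 𝒢, ℋᵗ)`, where `𝒢` is saturated
and the graph is finite. -/
noncomputable def rank (𝒢 : Set (Set V)) : ℕ :=
  ∑ᶠ c : OrdClass Γ 𝒢, (Nat.card (ClassElems Γ 𝒢 c) - 1)

/-- The group `Aut⁰(Γ) = Aut(Γ) ∩ O` for `O = Out⁰(A_Γ; 𝒢, ℋᵗ)`, as a subgroup of `Out(A_Γ)`. -/
def autZero (𝒢 ℋ : Set (Set V)) : Subgroup (OutAut (RAAG Γ)) :=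
  (graphOut Γ).range ⊓ relOutZero Γ 𝒢 ℋ

end RAAG

/-- `(W, S)` is a Coxeter system, for a subset `S` of the group `W`: for some Coxeter matrix `M`
indexed by `S`, the inclusion of `S` induces an isomorphism from the Coxeter group of `M` to `W`. -/
def IsCoxeterPair (W : Type*) [Group W] (S : Set W) : Prop :=
  ∃ (M : CoxeterMatrix S) (cs : CoxeterSystem M W), ∀ s : S, cs.simple s = s

/-! The exponent sums `A_Γ → ℤ`, one for each vertex, have abelian target, so inner automorphisms do
not change them and they can be read off from an outer class. A graph automorphism is visible in
them, which gives injectivity of `graphOut`.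

Suppose `σ` lies in `O`. Stabilising `A_Δ` forces `σ Δ ⊆ Δ`. Every generator of `Out⁰` acts on
exponent sums triangularly for the standard order, so `v ≤ σ v`. Together these say `v ≤_𝒢 σ v`; the
same for `σ⁻¹` shows that `σ` preserves each class (`cls_apply_of_graphOut_mem`).

Conversely, equivalent vertices have the same neighbours apart from one another, so every family of
permutations of the classes is a graph automorphism (`permAut`). Its class lies in `Out⁰` because a
swap of two equivalent vertices is a product of transvections and inversions
(`graphOut_swap_mem_outZero`). Members of `𝒢` are unions of classes, hence stabilised. Saturation
makes the class of any vertex of a member of `ℋ` a singleton, hence fixed (`eq_of_mem_of_cls_eq`).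

The Coxeter statement then concerns products of symmetric groups. Adjacent transpositions satisfy
the type `A` relations and generate; that no further relations are needed follows by induction from
a coset normal form (`IsBraidSeq.eq_one_of_map_eq_one`). Direct products add commutation between the
factors. -/

/-! ### The symmetric group as a Coxeter group of type `A` -/

/-- The product `s k * s (k + 1) * ⋯ * s (k + m - 1)` of consecutive terms of a sequence. -/
def ascProd {G : Type*} [Monoid G] (s : ℕ → G) : ℕ → ℕ → G
  | _, 0 => 1
  | k, m + 1 => s k * ascProd s (k + 1) m

/-- The relations of the Coxeter group of type `A` for the first `n` terms of a sequence. -/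
structure IsBraidSeq {G : Type*} [Group G] (s : ℕ → G) (n : ℕ) : Prop where
  sq : ∀ i < n, s i * s i = 1
  comm : ∀ i j, i + 1 < j → j < n → Commute (s i) (s j)
  braid : ∀ i, i + 1 < n → s i * s (i + 1) * s i = s (i + 1) * s i * s (i + 1)

namespace IsBraidSeq

variable {G : Type*} [Group G] {s : ℕ → G} {n : ℕ}

theorem mono (hs : IsBraidSeq s n) {m : ℕ} (h : m ≤ n) : IsBraidSeq s m :=
  ⟨fun i hi => hs.sq i (hi.trans_le h), fun i j hij hj => hs.comm i j hij (hj.trans_le h),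
    fun i hi => hs.braid i (hi.trans_le h)⟩

theorem commute_ascProd (hs : IsBraidSeq s n) (i m : ℕ) :
    ∀ k, i + 1 < k → k + m ≤ n → Commute (s i) (ascProd s k m) := by
  induction m with
  | zero => intro k _ _; exact Commute.one_right _
  | succ m ih =>
    intro k hk hm
    exact (hs.comm i k hk (by omega)).mul_right (ih (k + 1) (by omega) (by omega))

/-- The factor `s (j + 1)` commutes with everything to the left of `s j * s (j + 1)`; there the
braid relation turns it into `s j`, which commutes with the rest. -/
theorem mul_ascProd (hs : IsBraidSeq s n) (j m : ℕ) :
    ∀ k, k ≤ j → j + 1 < k + m → k + m ≤ n →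
      s (j + 1) * ascProd s k m = ascProd s k m * s j := by
  induction m with
  | zero => intro k _ _ _; omega
  | succ m ih =>
    intro k hk hj hm
    rcases hk.eq_or_lt with rfl | hk
    · obtain _ | m := m
      · omega
      have hc : s k * ascProd s (k + 2) m = ascProd s (k + 2) m * s k :=
        hs.commute_ascProd k m (k + 2) (by omega) (by omega)
      have hb := hs.braid k (by omega)
      simp only [ascProd]
      calc s (k + 1) * (s k * (s (k + 1) * ascProd s (k + 1 + 1) m))
          = s (k + 1) * s k * s (k + 1) * ascProd s (k + 2) m := by simp only [mul_assoc]
        _ = s k * s (k + 1) * (s k * ascProd s (k + 2) m) := by rw [← hb]; simp only [mul_assoc]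
        _ = _ := by rw [hc]; simp only [mul_assoc]
    · have hc : s k * s (j + 1) = s (j + 1) * s k := hs.comm k (j + 1) (by omega) (by omega)
      simp only [ascProd]
      rw [← mul_assoc, ← hc, mul_assoc, ih (k + 1) (by omega) (by omega) (by omega), mul_assoc]

/-- Every element of the subgroup generated by `s 0, …, s n` is the product of some
`s k * ⋯ * s n` and an element of the subgroup generated by `s 0, …, s (n - 1)`. -/
theorem exists_ascProd_mul (hs : IsBraidSeq s (n + 1)) {g : G}
    (hg : g ∈ Subgroup.closure (s '' Set.Iio (n + 1))) :
    ∃ k m, k + m = n + 1 ∧ ∃ h ∈ Subgroup.closure (s '' Set.Iio n), g = ascProd s k m * h := by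
  have step : ∀ i < n + 1, ∀ y, (∃ k m, k + m = n + 1 ∧
      ∃ h ∈ Subgroup.closure (s '' Set.Iio n), y = ascProd s k m * h) →
      ∃ k m, k + m = n + 1 ∧
        ∃ h ∈ Subgroup.closure (s '' Set.Iio n), s i * y = ascProd s k m * h := by
    rintro i hi _ ⟨k, m, hkm, h, hh, rfl⟩
    have gen_mem : ∀ j < n, s j ∈ Subgroup.closure (s '' Set.Iio n) := fun j hj =>
      Subgroup.subset_closure ⟨j, hj, rfl⟩
    -- Left multiplication by `s i` permutes the coset representatives or passes into `h`. For `i +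
    -- 1 < k` it commutes past, for `i + 1 = k` it lengthens the product, for `i = k` it cancels the
    -- first factor, and for `i > k` it emerges as `s (i - 1)`.
    rcases lt_trichotomy (i + 1) k with h1 | h1 | h1
    · refine ⟨k, m, hkm, s i * h, mul_mem (gen_mem i (by omega)) hh, ?_⟩
      have hc : s i * ascProd s k m = ascProd s k m * s i :=
        hs.commute_ascProd i m k h1 (by omega)
      rw [← mul_assoc, hc, mul_assoc]
    · subst h1
      exact ⟨i, m + 1, by omega, h, hh, by simp only [ascProd, mul_assoc]⟩
    · rcases (Nat.lt_succ_iff.1 h1).eq_or_lt with rfl | h2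
      · obtain _ | m := m
        · omega
        · refine ⟨k + 1, m, by omega, h, hh, ?_⟩
          simp only [ascProd]
          rw [mul_assoc, ← mul_assoc, hs.sq k hi, one_mul]
      · obtain _ | j := i
        · omega
        refine ⟨k, m, hkm, s j * h, mul_mem (gen_mem j (by omega)) hh, ?_⟩
        rw [← mul_assoc, hs.mul_ascProd j m k (by omega) (by omega) (by omega), mul_assoc]
  induction hg using Subgroup.closure_induction_left with
  | one => exact ⟨n + 1, 0, by omega, 1, one_mem _, by simp [ascProd]⟩
  | mul_left x hx y _ ih =>
    obtain ⟨i, hi, rfl⟩ := hx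
    exact step i hi y ih
  | inv_mul_cancel x hx y _ ih =>
    obtain ⟨i, hi, rfl⟩ := hx
    rw [inv_eq_of_mul_eq_one_right (hs.sq i hi)]
    exact step i hi y ih

/-- A homomorphism to a symmetric group that sends a braid sequence to transpositions of
consecutive points is injective on the subgroup generated by the sequence. -/
theorem eq_one_of_map_eq_one {α : Type*} [DecidableEq α] (π : G →* Equiv.Perm α) (e : ℕ → α) :
    ∀ n, IsBraidSeq s n → Set.InjOn e (Set.Iic n) →
      (∀ i < n, π (s i) = Equiv.swap (e i) (e (i + 1))) →
      ∀ g ∈ Subgroup.closure (s '' Set.Iio n), π g = 1 → g = 1 := by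
  intro n
  induction n with
  | zero =>
    intro _ _ _ g hg _
    simpa [Set.Iio_eq_empty_iff.2 (isMin_bot : IsMin (0 : ℕ))] using hg
  | succ n ih =>
    intro hs he hπ g hg hg1
    obtain ⟨k, m, hkm, h, hh, rfl⟩ := hs.exists_ascProd_mul hg
    -- The image of the last point determines the coset: `h` fixes `e (n + 1)` and the ascending
    -- product carries it to `e k`. So `π g = 1` forces `k = n + 1`, and the ascending product is
    -- empty.
    have hfix : π h (e (n + 1)) = e (n + 1) := by
      have hle : Subgroup.closure (s '' Set.Iio n) ≤
          (MulAction.stabilizer (Equiv.Perm α) (e (n + 1))).comap π := by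
        rw [Subgroup.closure_le]
        rintro _ ⟨i, hi, rfl⟩
        have hi : i < n := hi
        change π (s i) (e (n + 1)) = e (n + 1)
        rw [hπ i (by omega)]
        apply Equiv.swap_apply_of_ne_of_ne <;> intro h
        · have := he (by simp) (by simp; omega) h
          omega
        · have := he (by simp) (by simp; omega) h
          omega
      exact hle hh
    have hasc : ∀ m k, k + m = n + 1 → π (ascProd s k m) (e (n + 1)) = e k := by
      intro m
      induction m with
      | zero => rintro k rfl; simp [ascProd]
      | succ m ih' =>
        intro k hk
        rw [ascProd, map_mul, Equiv.Perm.mul_apply, ih' (k + 1) (by omega), hπ k (by omega),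
          Equiv.swap_apply_right]
    have hk : e (n + 1) = e k := by
      rw [← hasc m k hkm]
      conv_rhs => rw [← hfix]
      rw [← Equiv.Perm.mul_apply, ← map_mul, hg1, Equiv.Perm.one_apply]
    have hk' : n + 1 = k := he (by simp) (by simp; omega) hk
    obtain rfl : m = 0 := by omega
    simp only [ascProd, one_mul] at hg1 ⊢
    exact ih (hs.mono (by omega)) (he.mono (Set.Iic_subset_Iic.2 (by omega)))
      (fun i hi => hπ i (by omega)) h hh hg1

end IsBraidSeq

/-- Two transpositions sharing exactly one point multiply to a 3-cycle; disjoint ones commute. -/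
theorem CoxeterMatrix.A_isLiftable_swap (n : ℕ) :
    (CoxeterMatrix.A n).IsLiftable fun i : Fin n => Equiv.swap i.castSucc i.succ := by
  intro i j
  change _ ^ (if i = j then 1 else if (j : ℕ) + 1 = i ∨ (i : ℕ) + 1 = j then 3 else 2) = _
  split_ifs with h1 h2
  · subst h1; simp
  · have key : ∀ a b c : Fin (n + 1), a ≠ b → a ≠ c → b ≠ c →
        (Equiv.swap a b * Equiv.swap a c) ^ 3 = 1 := fun a b c hab hac hbc => by
      rw [← (Equiv.Perm.isThreeCycle_swap_mul_swap_same hab hac hbc).orderOf, pow_orderOf_eq_one]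
    rcases h2 with h2 | h2
    · have : i.castSucc = j.succ := by ext; simp [h2]
      beta_reduce
      rw [this, Equiv.swap_comm j.castSucc]
      apply key <;> simp [Fin.ext_iff] <;> omega
    · have : j.castSucc = i.succ := by ext; simp [h2]
      beta_reduce
      rw [this, Equiv.swap_comm i.castSucc]
      apply key <;> simp [Fin.ext_iff] <;> omega
  · have hd : Commute (Equiv.swap i.castSucc i.succ) (Equiv.swap j.castSucc j.succ) := by
      apply Equiv.Perm.Disjoint.commute
      apply Equiv.Perm.disjoint_swap_swap
      simp [Fin.ext_iff] at *
      omega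
    rw [hd.mul_pow, pow_two, pow_two, Equiv.swap_mul_self, Equiv.swap_mul_self, one_mul]

/-- Since simple reflections are involutions, `(s t) ^ 2 = 1` and `(s t) ^ 3 = 1` rearrange to the
commutation and braid relations. The default value `1` is never inspected, as all the relations
involve only indices below `n`. -/
theorem CoxeterMatrix.A_isBraidSeq {n : ℕ} {W : Type*} [Group W]
    (cs : CoxeterSystem (CoxeterMatrix.A n) W) :
    IsBraidSeq (fun i => if h : i < n then cs.simple ⟨i, h⟩ else 1) n := by
  refine ⟨fun i hi => by simp [hi], fun i j hij hj => ?_, fun i hi => ?_⟩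
  · have hi : i < n := by omega
    have h := cs.simple_mul_simple_pow ⟨i, hi⟩ ⟨j, hj⟩
    have hM : CoxeterMatrix.A n ⟨i, hi⟩ ⟨j, hj⟩ = 2 := by
      change (if _ then _ else _) = _
      rw [if_neg (by simp; omega), if_neg (by simp; omega)]
    rw [hM, pow_two] at h
    simp only [hi, hj, dif_pos]
    have h' := eq_inv_of_mul_eq_one_left h
    rwa [mul_inv_rev, cs.inv_simple, cs.inv_simple] at h'
  · have hi' : i < n := by omega
    have h := cs.simple_mul_simple_pow ⟨i, hi'⟩ ⟨i + 1, hi⟩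
    have hM : CoxeterMatrix.A n ⟨i, hi'⟩ ⟨i + 1, hi⟩ = 3 := by
      change (if _ then _ else _) = _
      rw [if_neg (by simp), if_pos (by simp)]
    rw [hM, pow_succ, pow_two] at h
    simp only [hi, hi', dif_pos]
    have h' : (cs.simple ⟨i, hi'⟩ * cs.simple ⟨i + 1, hi⟩ * cs.simple ⟨i, hi'⟩) *
        (cs.simple ⟨i + 1, hi⟩ * cs.simple ⟨i, hi'⟩ * cs.simple ⟨i + 1, hi⟩) = 1 := by
      rw [← h]; simp only [mul_assoc]
    rw [eq_inv_of_mul_eq_one_left h']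
    simp [mul_assoc]

/-- The symmetric group on `n + 1` letters, with the transpositions of consecutive letters, is a
Coxeter system of type `A n`. -/
theorem exists_coxeterSystem_perm_fin (n : ℕ) :
    ∃ cs : CoxeterSystem (CoxeterMatrix.A n) (Equiv.Perm (Fin (n + 1))),
      ∀ i, cs.simple i = Equiv.swap i.castSucc i.succ := by
  let cs := (CoxeterMatrix.A n).toCoxeterSystem
  let π := cs.lift ⟨_, CoxeterMatrix.A_isLiftable_swap n⟩
  have hπ : ∀ i, π (cs.simple i) = Equiv.swap i.castSucc i.succ := cs.lift_apply_simple _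
  have hinj : Function.Injective π := by
    rw [injective_iff_map_eq_one]
    intro g hg
    -- Only indices at most `n` matter, so the reduction modulo `n + 1` never wraps around.
    refine IsBraidSeq.eq_one_of_map_eq_one π (fun i => Fin.ofNat (n + 1) i) n
      (CoxeterMatrix.A_isBraidSeq cs) ?_ ?_ g ?_ hg
    · intro i hi j hj hij
      simp only [Set.mem_Iic] at hi hj
      simpa [Fin.ext_iff, Nat.mod_eq_of_lt (Nat.lt_succ_of_le hi),
        Nat.mod_eq_of_lt (Nat.lt_succ_of_le hj)] using hij
    · intro i hi
      rw [dif_pos hi, hπ]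
      congr 1 <;> ext <;> simp <;> rw [Nat.mod_eq_of_lt (by omega)]
    · have : Set.range cs.simple ⊆
          (fun i => if h : i < n then cs.simple ⟨i, h⟩ else 1) '' Set.Iio n := by
        rintro _ ⟨i, rfl⟩
        exact ⟨i, i.2, by simp⟩
      refine Subgroup.closure_mono this ?_
      rw [cs.subgroup_closure_range_simple]
      exact Subgroup.mem_top g
  have hsurj : Function.Surjective π := by
    rw [← MonoidHom.mrange_eq_top, eq_top_iff, ← Equiv.Perm.mclosure_swap_castSucc_succ,
      Submonoid.closure_le]
    rintro _ ⟨i, rfl⟩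
    exact ⟨cs.simple i, hπ i⟩
  exact ⟨cs.map (MulEquiv.ofBijective π ⟨hinj, hsurj⟩), hπ⟩

/-- Injectivity and nontriviality of the simple reflections are recorded so that they stay distinct
in a direct product, which is needed to count them. -/
theorem exists_coxeterSystem_perm (α : Type*) [Finite α] [Nonempty α] :
    ∃ cs : CoxeterSystem (CoxeterMatrix.A (Nat.card α - 1)) (Equiv.Perm α),
      Function.Injective cs.simple ∧ ∀ i, cs.simple i ≠ 1 := by
  obtain ⟨cs, hcs⟩ := exists_coxeterSystem_perm_fin (Nat.card α - 1)
  have hpos : 0 < Nat.card α := Nat.card_pos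
  let e : Fin (Nat.card α - 1 + 1) ≃ α :=
    (finCongr (by omega)).trans (Finite.equivFin α).symm
  refine ⟨cs.map e.permCongrHom, fun i j hij => ?_, fun i hi => ?_⟩
  · simp only [CoxeterSystem.map_simple, EmbeddingLike.apply_eq_iff_eq, hcs] at hij
    have h1 : Equiv.swap j.castSucc j.succ i.castSucc = i.succ := by
      rw [← hij, Equiv.swap_apply_left]
    rw [Equiv.swap_apply_def] at h1
    split_ifs at h1 <;> simp only [Fin.ext_iff, Fin.val_castSucc, Fin.val_succ] at * <;> omega
  · simp only [CoxeterSystem.map_simple, EmbeddingLike.map_eq_one_iff, hcs] at hi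
    have h1 := Equiv.swap_apply_left i.castSucc i.succ
    rw [hi, Equiv.Perm.one_apply] at h1
    exact i.castSucc_lt_succ.ne h1

/-! ### Direct products of Coxeter systems -/

/-- The Coxeter matrix of a direct product of Coxeter groups. -/
def CoxeterMatrix.sigma {ι : Type*} [DecidableEq ι] {B : ι → Type*}
    (M : ∀ i, CoxeterMatrix (B i)) : CoxeterMatrix (Σ i, B i) where
  M := Matrix.of fun x y => if h : x.1 = y.1 then M y.1 (h ▸ x.2) y.2 else 2
  isSymm := by
    ext ⟨i, x⟩ ⟨j, y⟩
    by_cases h : i = j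
    · subst h; simp [(M i).symmetric x y]
    · simp [h, Ne.symm h]
  diagonal := by rintro ⟨i, x⟩; simp
  off_diagonal := by
    rintro ⟨i, x⟩ ⟨j, y⟩ hxy
    by_cases h : i = j
    · subst h
      have : x ≠ y := fun h => hxy (by rw [h])
      simpa using (M i).off_diagonal x y this
    · simp [h]

theorem CoxeterMatrix.sigma_same {ι : Type*} [DecidableEq ι] {B : ι → Type*}
    (M : ∀ i, CoxeterMatrix (B i)) (i : ι) (x y : B i) :
    CoxeterMatrix.sigma M ⟨i, x⟩ ⟨i, y⟩ = M i x y := by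
  change dite _ _ _ = _
  simp

theorem CoxeterMatrix.sigma_of_ne {ι : Type*} [DecidableEq ι] {B : ι → Type*}
    (M : ∀ i, CoxeterMatrix (B i)) {i j : ι} (h : i ≠ j) (x : B i) (y : B j) :
    CoxeterMatrix.sigma M ⟨i, x⟩ ⟨j, y⟩ = 2 := by
  change dite _ _ _ = _
  simp [h]

/-- The direct product of finitely many Coxeter systems is a Coxeter system. -/
theorem exists_coxeterSystem_pi {ι : Type*} [DecidableEq ι] [Finite ι] {B : ι → Type*}
    {W : ι → Type*} [∀ i, Group (W i)] {M : ∀ i, CoxeterMatrix (B i)}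
    (cs : ∀ i, CoxeterSystem (M i) (W i)) :
    ∃ cs' : CoxeterSystem (CoxeterMatrix.sigma M) (∀ i, W i),
      ∀ i b, cs'.simple ⟨i, b⟩ = Pi.mulSingle i ((cs i).simple b) := by
  have := Fintype.ofFinite ι
  let cs₀ := (CoxeterMatrix.sigma M).toCoxeterSystem
  have hf : (CoxeterMatrix.sigma M).IsLiftable fun x =>
      (Pi.mulSingle x.1 ((cs x.1).simple x.2) : ∀ i, W i) := by
    rintro ⟨i, x⟩ ⟨j, y⟩
    by_cases h : i = j
    · subst h
      rw [CoxeterMatrix.sigma_same]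
      simp only
      rw [← Pi.mulSingle_mul, ← Pi.mulSingle_pow, (cs i).simple_mul_simple_pow, Pi.mulSingle_one]
    · rw [CoxeterMatrix.sigma_of_ne M h, (Pi.mulSingle_commute h _ _).mul_pow]
      simp only
      rw [← Pi.mulSingle_pow, ← Pi.mulSingle_pow]
      simp
  have hg : ∀ i, (M i).IsLiftable fun b => cs₀.simple ⟨i, b⟩ := by
    intro i b b'
    rw [← CoxeterMatrix.sigma_same M, cs₀.simple_mul_simple_pow]
  let φ : ∀ i, W i →* (CoxeterMatrix.sigma M).Group := fun i => (cs i).lift ⟨_, hg i⟩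
  have hφ : ∀ i b, φ i ((cs i).simple b) = cs₀.simple ⟨i, b⟩ := fun i =>
    (cs i).lift_apply_simple (hg i)
  have hcomm : Pairwise fun i j => ∀ x y, Commute (φ i x) (φ j y) := by
    intro i j hij x y
    induction x using (cs i).simple_induction with
    | one => rw [map_one]; exact Commute.one_left _
    | mul w w' hw hw' => rw [map_mul]; exact hw.mul_left hw'
    | simple b =>
      induction y using (cs j).simple_induction with
      | one => rw [map_one]; exact Commute.one_right _
      | mul w w' hw hw' => rw [map_mul]; exact hw.mul_right hw'
      | simple b' =>
        rw [hφ, hφ]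
        have h := cs₀.simple_mul_simple_pow ⟨i, b⟩ ⟨j, b'⟩
        rw [CoxeterMatrix.sigma_of_ne M hij, pow_two] at h
        have h' := eq_inv_of_mul_eq_one_left h
        rwa [mul_inv_rev, cs₀.inv_simple, cs₀.inv_simple] at h'
  -- The entries `2` between different factors make the images of the `φ i` commute, so they
  -- assemble into an inverse of `E`; both composites are checked on simple reflections.
  let F : (∀ i, W i) →* (CoxeterMatrix.sigma M).Group := MonoidHom.noncommPiCoprod φ hcomm
  let E : (CoxeterMatrix.sigma M).Group →* (∀ i, W i) := cs₀.lift ⟨_, hf⟩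
  have hE : ∀ x, E (cs₀.simple x) = Pi.mulSingle x.1 ((cs x.1).simple x.2) :=
    cs₀.lift_apply_simple hf
  have hF : ∀ i w, F (Pi.mulSingle i w) = φ i w := fun i w =>
    MonoidHom.noncommPiCoprod_mulSingle φ i w
  have hFE : F.comp E = MonoidHom.id _ := by
    apply cs₀.ext_simple
    rintro ⟨i, b⟩
    rw [MonoidHom.comp_apply, hE, hF, hφ, MonoidHom.id_apply]
  have hEF : E.comp F = MonoidHom.id _ := by
    apply MonoidHom.pi_ext
    intro i w
    have : (E.comp (φ i)) = MonoidHom.mulSingle W i := by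
      apply (cs i).ext_simple
      intro b
      rw [MonoidHom.comp_apply, hφ, hE]
      rfl
    rw [MonoidHom.comp_apply, hF, MonoidHom.id_apply]
    exact DFunLike.congr_fun this w
  exact ⟨cs₀.map (MonoidHom.toMulEquiv E F hFE hEF), fun i b => hE ⟨i, b⟩⟩

/-- A Coxeter system with distinct simple reflections gives a Coxeter pair. -/
theorem CoxeterSystem.isCoxeterPair_range {B W : Type*} [Group W] {M : CoxeterMatrix B}
    (cs : CoxeterSystem M W) (h : Function.Injective cs.simple) :
    IsCoxeterPair W (Set.range cs.simple) :=
  ⟨_, cs.reindex (Equiv.ofInjective _ h), fun s => by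
    rw [CoxeterSystem.reindex_simple, Equiv.apply_ofInjective_symm h]⟩
namespace RAAG

variable {V : Type*} {Γ : SimpleGraph V}

/-! ### Exponent sums -/

open Classical in
/-- The exponent sum of a vertex. -/
noncomputable def expSum (Γ : SimpleGraph V) (u : V) : RAAG Γ →* Multiplicative ℤ :=
  PresentedGroup.toGroup (f := fun v => if v = u then Multiplicative.ofAdd 1 else 1) (by
    rintro _ ⟨v, w, _, rfl⟩
    rw [map_mul, map_mul, map_mul, map_inv, map_inv, mul_inv_cancel_comm, mul_inv_cancel])

theorem expSum_gen_self (u : V) : expSum Γ u (gen Γ u) = Multiplicative.ofAdd 1 :=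
  (PresentedGroup.toGroup.of _).trans (if_pos rfl)

theorem expSum_gen_of_ne {u v : V} (h : v ≠ u) : expSum Γ u (gen Γ v) = 1 :=
  (PresentedGroup.toGroup.of _).trans (if_neg h)

theorem expSum_gen_eq_one_iff {u v : V} : expSum Γ u (gen Γ v) = 1 ↔ v ≠ u := by
  refine ⟨fun h => ?_, expSum_gen_of_ne⟩
  rintro rfl
  rw [expSum_gen_self] at h
  exact one_ne_zero (Multiplicative.ofAdd.injective h)

theorem expSum_conj (u : V) (g x : RAAG Γ) :
    expSum Γ u (MulAut.conj g x) = expSum Γ u x := by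
  rw [MulAut.conj_apply, map_mul, map_mul, map_inv, mul_inv_cancel_comm]

/-- Two representatives differ by a conjugation, which a homomorphism to an abelian group does not
see. -/
theorem expSum_apply_eq_of_mk_eq {φ ψ : MulAut (RAAG Γ)}
    (h : (φ : OutAut (RAAG Γ)) = ψ) (u : V) (x : RAAG Γ) :
    expSum Γ u (φ x) = expSum Γ u (ψ x) := by
  obtain ⟨g, hg⟩ := QuotientGroup.eq.1 h.symm
  have : φ = MulAut.conj (ψ g) * ψ := by
    rw [inv_mul_eq_iff_eq_mul.1 hg.symm]
    ext x
    simp [MulAut.conj_apply]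
  rw [this, MulAut.mul_apply, expSum_conj]

theorem expSum_eq_one_of_mem_special {Δ : Set V} {u : V} (hu : u ∉ Δ) {x : RAAG Γ}
    (hx : x ∈ special Γ Δ) : expSum Γ u x = 1 := by
  have hle : special Γ Δ ≤ (expSum Γ u).ker := by
    rw [special, Subgroup.closure_le]
    rintro _ ⟨v, hv, rfl⟩
    exact expSum_gen_of_ne fun h => hu (h ▸ hv)
  exact hle hx

theorem graphOut_injective : Function.Injective (graphOut Γ) := by
  intro σ τ h
  ext v
  have h' := expSum_apply_eq_of_mk_eq (φ := graphAut Γ σ) (ψ := graphAut Γ τ) h (τ v) (gen Γ v)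
  rw [graphAut_gen, graphAut_gen, expSum_gen_self] at h'
  by_contra hne
  rw [expSum_gen_of_ne hne] at h'
  exact one_ne_zero (Multiplicative.ofAdd.injective h').symm

theorem mem_of_graphOut_stabilises {σ : Γ ≃g Γ} {Δ : Set V}
    (h : (graphOut Γ σ).Stabilises (special Γ Δ)) {v : V} (hv : v ∈ Δ) : σ v ∈ Δ := by
  obtain ⟨φ, hφ, hmap⟩ := h
  have hmem : φ (gen Γ v) ∈ special Γ Δ := by
    rw [← hmap]
    exact ⟨gen Γ v, Subgroup.subset_closure ⟨v, hv, rfl⟩, rfl⟩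
  by_contra hσ
  have h1 := expSum_eq_one_of_mem_special hσ hmem
  rw [expSum_apply_eq_of_mk_eq (ψ := graphAut Γ σ) hφ, graphAut_gen] at h1
  exact expSum_gen_eq_one_iff.1 h1 rfl

/-! ### The action of `Out⁰` on exponent sums respects the standard ordering -/

/-- The elements all of whose exponent sums are supported on the vertices above `v`. -/
noncomputable def upperSupported (Γ : SimpleGraph V) (v : V) : Subgroup (RAAG Γ) :=
  ⨅ u, ⨅ _ : ¬ OrdLE Γ ∅ v u, (expSum Γ u).ker

theorem mem_upperSupported {v : V} {x : RAAG Γ} :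
    x ∈ upperSupported Γ v ↔ ∀ u, ¬ OrdLE Γ ∅ v u → expSum Γ u x = 1 := by
  simp [upperSupported, Subgroup.mem_iInf]

/-- The automorphisms that preserve all the subgroups `upperSupported Γ v`. -/
noncomputable def upperAut (Γ : SimpleGraph V) : Subgroup (MulAut (RAAG Γ)) where
  carrier := {φ | ∀ v x, φ x ∈ upperSupported Γ v ↔ x ∈ upperSupported Γ v}
  one_mem' _ _ := Iff.rfl
  mul_mem' {φ ψ} hφ hψ v x := (hφ v (ψ x)).trans (hψ v x)
  inv_mem' {φ} hφ v x := by
    rw [← hφ, MulAut.apply_inv_self]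

theorem mem_upperAut_of_expSum {φ : MulAut (RAAG Γ)}
    (h : ∀ u x, expSum Γ u (φ x) = expSum Γ u x) : φ ∈ upperAut Γ := fun v x => by
  simp only [mem_upperSupported, h]

theorem IsInversion.mem_upperAut {v : V} {φ : MulAut (RAAG Γ)} (h : IsInversion Γ v φ) :
    φ ∈ upperAut Γ := by
  have key : ∀ u x, expSum Γ u (φ x) = expSum Γ u x ∨
      expSum Γ u (φ x) = (expSum Γ u x)⁻¹ := by
    intro u x
    by_cases hu : u = v
    · subst hu
      right
      have : (expSum Γ u).comp φ.toMonoidHom = (expSum Γ u)⁻¹ := by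
        refine PresentedGroup.ext fun w => ?_
        change expSum Γ u (φ (gen Γ w)) = (expSum Γ u (gen Γ w))⁻¹
        by_cases hw : w = u
        · subst hw; rw [h.1, map_inv]
        · rw [h.2 w hw, expSum_gen_of_ne hw, inv_one]
      exact DFunLike.congr_fun this x
    · left
      have : (expSum Γ u).comp φ.toMonoidHom = expSum Γ u := by
        refine PresentedGroup.ext fun w => ?_
        change expSum Γ u (φ (gen Γ w)) = expSum Γ u (gen Γ w)
        by_cases hw : w = v
        · subst hw; rw [h.1, map_inv, expSum_gen_of_ne (Ne.symm hu), inv_one]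
        · rw [h.2 w hw]
      exact DFunLike.congr_fun this x
  intro a x
  simp only [mem_upperSupported]
  refine forall₂_congr fun u _ => ?_
  rcases key u x with h | h <;> simp [h]

/-- Only the exponent sum at `w` changes, by the addition of the one at `v`. If `a ≤ w`, no
condition is imposed at `w`. Otherwise `a ≤ v` fails too, by transitivity, so the added sum
vanishes. With the empty family, `OrdLE` is the standard order. -/
theorem IsTransvection.mem_upperAut {v w : V} {φ : MulAut (RAAG Γ)}
    (h : IsTransvection Γ v w φ) : φ ∈ upperAut Γ := by
  obtain ⟨hwv, hle, hv, hfix⟩ := h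
  have hne : ∀ u x, u ≠ w → expSum Γ u (φ x) = expSum Γ u x := by
    intro u x hu
    have : (expSum Γ u).comp φ.toMonoidHom = expSum Γ u := by
      refine PresentedGroup.ext fun z => ?_
      change expSum Γ u (φ (gen Γ z)) = expSum Γ u (gen Γ z)
      by_cases hz : z = v
      · subst hz; rw [hv, map_mul, expSum_gen_of_ne (Ne.symm hu), mul_one]
      · rw [hfix z hz]
    exact DFunLike.congr_fun this x
  have hw : ∀ x, expSum Γ w (φ x) = expSum Γ w x * expSum Γ v x := by
    intro x
    have : (expSum Γ w).comp φ.toMonoidHom = expSum Γ w * expSum Γ v := by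
      refine PresentedGroup.ext fun z => ?_
      change expSum Γ w (φ (gen Γ z)) = expSum Γ w (gen Γ z) * expSum Γ v (gen Γ z)
      by_cases hz : z = v
      · subst hz; rw [hv, map_mul, expSum_gen_self, expSum_gen_self]
      · rw [hfix z hz, expSum_gen_of_ne hz, mul_one]
    exact DFunLike.congr_fun this x
  have hvw : OrdLE Γ ∅ v w := ⟨hle, fun _ h => h.elim⟩
  intro a x
  simp only [mem_upperSupported]
  by_cases haw : OrdLE Γ ∅ a w
  · refine forall₂_congr fun u hu => ?_
    rw [hne u x (by rintro rfl; exact hu haw)]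
  · have hav : ¬ OrdLE Γ ∅ a v := fun h => haw (h.trans hvw)
    constructor <;> intro H u hu <;> have H1 := H u hu <;> have H2 := H v hav
    · by_cases huw : u = w
      · subst huw
        rw [hne v x hwv] at H2
        rwa [hw, H2, mul_one] at H1
      · rwa [hne u x huw] at H1
    · by_cases huw : u = w
      · subst huw
        rw [hw, H1, H2, one_mul]
      · rwa [hne u x huw]

theorem IsPartialConj.mem_upperAut {v : V} {K : Set V} {φ : MulAut (RAAG Γ)}
    (h : IsPartialConj Γ v K φ) : φ ∈ upperAut Γ := by
  refine mem_upperAut_of_expSum fun u x => ?_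
  have : (expSum Γ u).comp φ.toMonoidHom = expSum Γ u := by
    refine PresentedGroup.ext fun w => ?_
    change expSum Γ u (φ (gen Γ w)) = expSum Γ u (gen Γ w)
    by_cases hw : w ∈ K
    · rw [h.2.1 w hw, map_mul, map_mul, map_inv, mul_inv_cancel_comm]
    · rw [h.2.2 w hw]
  exact DFunLike.congr_fun this x

/-- The generators give some representative in `upperAut Γ`; invariance of exponent sums under inner
automorphisms transfers this to every representative. -/
theorem mem_upperAut_of_mk_mem_outZero {φ : MulAut (RAAG Γ)}
    (h : (φ : OutAut (RAAG Γ)) ∈ outZero Γ) : φ ∈ upperAut Γ := by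
  have hle : outZero Γ ≤ (upperAut Γ).map (QuotientGroup.mk' _) := by
    rw [outZero, Subgroup.closure_le]
    rintro _ ⟨ψ, rfl, ⟨v, hψ⟩ | ⟨v, w, hψ⟩ | ⟨v, K, hψ⟩⟩
    · exact ⟨ψ, hψ.mem_upperAut, rfl⟩
    · exact ⟨ψ, hψ.mem_upperAut, rfl⟩
    · exact ⟨ψ, hψ.mem_upperAut, rfl⟩
  obtain ⟨ψ, hψ, hψφ⟩ := hle h
  intro v x
  rw [← hψ v x, mem_upperSupported, mem_upperSupported]
  simp only [expSum_apply_eq_of_mk_eq (φ := ψ) (ψ := φ) hψφ]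

theorem neighborSet_subset_of_graphOut_mem_outZero {σ : Γ ≃g Γ} (h : graphOut Γ σ ∈ outZero Γ)
    (v : V) : Γ.neighborSet v ⊆ starSet Γ (σ v) := by
  have h1 : gen Γ v ∈ upperSupported Γ v := mem_upperSupported.2 fun u hu =>
    expSum_gen_of_ne (by rintro rfl; exact hu (OrdLE.refl Γ ∅ v))
  have h2 := ((mem_upperAut_of_mk_mem_outZero (φ := graphAut Γ σ) h) v (gen Γ v)).2 h1
  rw [graphAut_gen, mem_upperSupported] at h2
  by_contra hv
  exact expSum_gen_eq_one_iff.1 (h2 (σ v) fun h => hv h.1) rfl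

/-- Graph automorphisms in `O` move every vertex within its `∼_𝒢`-class. -/
theorem cls_apply_of_graphOut_mem {𝒢 ℋ : Set (Set V)} {σ : Γ ≃g Γ}
    (h : graphOut Γ σ ∈ relOutZero Γ 𝒢 ℋ) (v : V) : cls Γ 𝒢 (σ v) = cls Γ 𝒢 v := by
  have key : ∀ τ : Γ ≃g Γ, graphOut Γ τ ∈ relOutZero Γ 𝒢 ℋ → ∀ v, OrdLE Γ 𝒢 v (τ v) :=
    fun τ hτ v => ⟨neighborSet_subset_of_graphOut_mem_outZero hτ.2 v, fun Δ hΔ hv =>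
      mem_of_graphOut_stabilises (hτ.1.1 _ ⟨Δ, hΔ, rfl⟩) hv⟩
  have hinv : graphOut Γ σ⁻¹ ∈ relOutZero Γ 𝒢 ℋ := by
    rw [map_inv]; exact inv_mem h
  refine Quotient.sound ⟨?_, key σ h v⟩
  -- The inverse, applied at `σ v`, supplies the reverse comparison.
  have h' := key σ⁻¹ hinv (σ v)
  rwa [show σ⁻¹ (σ v) = v from σ.symm_apply_apply v] at h'

/-! ### Exchanging two equivalent vertices -/

theorem commute_gen {v w : V} (h : Γ.Adj v w) : Commute (gen Γ v) (gen Γ w) :=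
  commutatorElement_eq_one_iff_commute.1 (PresentedGroup.one_of_mem
    (rels := {r : FreeGroup V | ∃ v w, Γ.Adj v w ∧
      r = FreeGroup.of v * FreeGroup.of w * (FreeGroup.of v)⁻¹ * (FreeGroup.of w)⁻¹})
    ⟨v, w, h, rfl⟩)

open Classical in
/-- The endomorphism that sends `v` to `g` and fixes the other vertices. -/
noncomputable def updateHom (v : V) (g : RAAG Γ)
    (hg : ∀ u, Γ.Adj v u → Commute g (gen Γ u)) : RAAG Γ →* RAAG Γ :=
  PresentedGroup.toGroup (f := fun u => if u = v then g else gen Γ u) (by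
    rintro _ ⟨a, b, hab, rfl⟩
    simp only [map_mul, map_inv, FreeGroup.lift_apply_of]
    rw [← commutatorElement_def, commutatorElement_eq_one_iff_commute]
    split_ifs with h1 h2 h2
    · exact Commute.refl g
    · exact hg b (h1 ▸ hab)
    · exact (hg a (h2 ▸ hab.symm)).symm
    · exact commute_gen hab)

theorem updateHom_gen_self (v : V) (g : RAAG Γ) (hg) :
    updateHom v g hg (gen Γ v) = g :=
  (PresentedGroup.toGroup.of _).trans (if_pos rfl)

theorem updateHom_gen_of_ne {v u : V} (h : u ≠ v) (g : RAAG Γ) (hg) :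
    updateHom v g hg (gen Γ u) = gen Γ u :=
  (PresentedGroup.toGroup.of _).trans (if_neg h)

theorem exists_isInversion (v : V) : ∃ φ : MulAut (RAAG Γ), IsInversion Γ v φ := by
  let f : RAAG Γ →* RAAG Γ := updateHom v (gen Γ v)⁻¹ fun u hu => (commute_gen hu).inv_left
  have hf : f.comp f = MonoidHom.id _ := by
    refine PresentedGroup.ext fun u => ?_
    change f (f (gen Γ u)) = gen Γ u
    by_cases hu : u = v
    · subst hu; simp only [f, updateHom_gen_self, map_inv, inv_inv]
    · simp only [f, updateHom_gen_of_ne hu]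
  exact ⟨MonoidHom.toMulEquiv f f hf hf, updateHom_gen_self v _ fun _ hu => (commute_gen hu).inv_left,
    fun _ hu => updateHom_gen_of_ne hu _ fun _ hu => (commute_gen hu).inv_left⟩

theorem exists_isTransvection {v w : V} (hvw : v ≠ w) (h : Γ.neighborSet v ⊆ starSet Γ w) :
    ∃ φ : MulAut (RAAG Γ), IsTransvection Γ v w φ := by
  have hc : ∀ u, Γ.Adj v u → Commute (gen Γ w) (gen Γ u) := by
    intro u hu
    rcases h hu with rfl | hwu
    · exact Commute.refl _
    · exact commute_gen hwu
  have hc₁ : ∀ u, Γ.Adj v u → Commute (gen Γ v * gen Γ w) (gen Γ u) := fun u hu =>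
    (commute_gen hu).mul_left (hc u hu)
  let f : RAAG Γ →* RAAG Γ := updateHom v (gen Γ v * gen Γ w) hc₁
  let f' : RAAG Γ →* RAAG Γ := updateHom v (gen Γ v * (gen Γ w)⁻¹) fun u hu =>
    (commute_gen hu).mul_left (hc u hu).inv_left
  have hf : f'.comp f = MonoidHom.id _ := by
    refine PresentedGroup.ext fun u => ?_
    change f' (f (gen Γ u)) = gen Γ u
    by_cases hu : u = v
    · subst hu
      simp only [f, f', updateHom_gen_self, map_mul, updateHom_gen_of_ne hvw.symm,
        inv_mul_cancel_right]
    · simp only [f, f', updateHom_gen_of_ne hu]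
  have hf' : f.comp f' = MonoidHom.id _ := by
    refine PresentedGroup.ext fun u => ?_
    change f (f' (gen Γ u)) = gen Γ u
    by_cases hu : u = v
    · subst hu
      simp only [f, f', updateHom_gen_self, map_mul, map_inv, updateHom_gen_of_ne hvw.symm,
        mul_inv_cancel_right]
    · simp only [f, f', updateHom_gen_of_ne hu]
  exact ⟨MonoidHom.toMulEquiv f f' hf hf', hvw, h, updateHom_gen_self v _ hc₁,
    fun _ hu => updateHom_gen_of_ne hu _ hc₁⟩

theorem mulAut_inv_apply_eq_iff {A : Type*} [Group A] {φ : MulAut A} {x y : A} :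
    φ⁻¹ x = y ↔ x = φ y :=
  φ.symm_apply_eq

/-- A graph automorphism exchanging two equivalent vertices is a product of transvections and
inversions. -/
theorem graphOut_swap_mem_outZero {σ : Γ ≃g Γ} {v w : V} (hvw : v ≠ w) (hv : σ v = w)
    (hw : σ w = v) (hfix : ∀ u, u ≠ v → u ≠ w → σ u = u)
    (h : Γ.neighborSet v ⊆ starSet Γ w) (h' : Γ.neighborSet w ⊆ starSet Γ v) :
    graphOut Γ σ ∈ outZero Γ := by
  obtain ⟨ι, hι⟩ := exists_isInversion (Γ := Γ) v
  obtain ⟨κ, hκ⟩ := exists_isInversion (Γ := Γ) w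
  obtain ⟨τ, hτ⟩ := exists_isTransvection hvw h
  obtain ⟨ρ, hρ⟩ := exists_isTransvection hvw.symm h'
  have mem : ∀ φ : MulAut (RAAG Γ), ((∃ v, IsInversion Γ v φ) ∨
      (∃ v w, IsTransvection Γ v w φ) ∨ ∃ v K, IsPartialConj Γ v K φ) →
      (φ : OutAut (RAAG Γ)) ∈ outZero Γ := fun φ hφ => Subgroup.subset_closure ⟨φ, rfl, hφ⟩
  have mι := mem ι (Or.inl ⟨v, hι⟩)
  have mκ := mem κ (Or.inl ⟨w, hκ⟩)
  have mτ := mem τ (Or.inr (Or.inl ⟨v, w, hτ⟩))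
  have mρ := mem ρ (Or.inr (Or.inl ⟨w, v, hρ⟩))
  obtain ⟨-, -, hτv, hτfix⟩ := hτ
  obtain ⟨-, -, hρw, hρfix⟩ := hρ
  have hτw := hτfix w hvw.symm
  have hρv := hρfix v hvw
  have hιw := hι.2 w hvw.symm
  have hκv := hκ.2 v hvw
  have hτw' : τ⁻¹ (gen Γ w) = gen Γ w := mulAut_inv_apply_eq_iff.2 hτw.symm
  have hρv' : ρ⁻¹ (gen Γ v) = gen Γ v := mulAut_inv_apply_eq_iff.2 hρv.symm
  have hτv' : τ⁻¹ (gen Γ v) = gen Γ v * (gen Γ w)⁻¹ := mulAut_inv_apply_eq_iff.2 (by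
    rw [map_mul, map_inv, hτv, hτw, mul_inv_cancel_right])
  have hρw' : ρ⁻¹ (gen Γ w) = gen Γ w * (gen Γ v)⁻¹ := mulAut_inv_apply_eq_iff.2 (by
    rw [map_mul, map_inv, hρw, hρv, mul_inv_cancel_right])
  -- This lifts the factorisation of a 2 × 2 permutation matrix into three elementary matrices and a
  -- sign. The factor `ι * τ⁻¹ * ι` is the left transvection `v ↦ w v`; using the left side here
  -- makes the identity hold even if `v` and `w` do not commute. Then `τ * ρ⁻¹ * (ι * τ⁻¹ * ι)`
  -- sends `v ↦ w` and `w ↦ v⁻¹`, and `κ` corrects the sign.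
  have key : graphAut Γ σ = τ * ρ⁻¹ * ι * τ⁻¹ * ι * κ := by
    refine MulEquiv.toMonoidHom_injective (PresentedGroup.ext fun u => ?_)
    change graphAut Γ σ (gen Γ u) = (τ * ρ⁻¹ * ι * τ⁻¹ * ι * κ) (gen Γ u)
    rw [graphAut_gen]
    simp only [MulAut.mul_apply]
    by_cases huv : u = v
    · subst huv
      simp only [hv, hκv, hι.1, map_inv, map_mul, hτv', hιw, hρv', hρw', hτv, hτw]
      group
    by_cases huw : u = w
    · subst huw
      simp only [hw, hκ.1, map_inv, map_mul, hιw, hτw', hρw', hτv, hτw]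
      group
    rw [hfix u huv huw, hκ.2 u huw, hι.2 u huv,
      mulAut_inv_apply_eq_iff.2 (hτfix u huv).symm, hι.2 u huv,
      mulAut_inv_apply_eq_iff.2 (hρfix u huw).symm, hτfix u huv]
  change ((graphAut Γ σ : MulAut (RAAG Γ)) : OutAut (RAAG Γ)) ∈ outZero Γ
  rw [key]
  exact mul_mem (mul_mem (mul_mem (mul_mem (mul_mem mτ (inv_mem mρ)) mι) (inv_mem mτ)) mι) mκ

end RAAG
namespace RAAG

variable {V : Type*} {Γ : SimpleGraph V}

/-! ### Permutations of the equivalence classes -/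

/-- The ends of the edge are moved up one at a time. A link lies only in the star of the larger
vertex, so coincidences arise, and the one that cannot be repaired is `v' = w'`. -/
theorem adj_of_ordLE {𝒢 : Set (Set V)} {v w v' w' : V} (h : Γ.Adj v w)
    (hv : OrdLE Γ 𝒢 v v') (hw : OrdLE Γ 𝒢 w w') (hne : v' ≠ w') : Γ.Adj v' w' := by
  rcases hv.1 h with rfl | hvw
  · rcases hw.1 h.symm with rfl | hwv
    · exact h.symm
    · rcases hv.1 hwv.symm with rfl | hww
      · exact (hne rfl).elim
      · exact hww
  · rcases hw.1 hvw.symm with rfl | hwv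
    · exact (hne rfl).elim
    · exact hwv.symm

theorem ordLE_of_cls_eq {𝒢 : Set (Set V)} {v w : V} (h : cls Γ 𝒢 v = cls Γ 𝒢 w) :
    OrdLE Γ 𝒢 v w :=
  (Quotient.exact h : (ordSetoid Γ 𝒢).r v w).1

/-- This replaces transport along `cls Γ 𝒢 x = c`, an equality that is not definitional for a
general member of `c`. -/
theorem perm_apply_cls {𝒢 : Set (Set V)} (p : ∀ c, Equiv.Perm (ClassElems Γ 𝒢 c))
    (c : OrdClass Γ 𝒢) (x : ClassElems Γ 𝒢 c) : (p (cls Γ 𝒢 x) ⟨x, rfl⟩ : V) = p c x := by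
  obtain ⟨v, rfl⟩ := x
  rfl

theorem perm_inv_apply_cls {𝒢 : Set (Set V)} (p : ∀ c, Equiv.Perm (ClassElems Γ 𝒢 c)) (v : V) :
    (p⁻¹ (cls Γ 𝒢 (p (cls Γ 𝒢 v) ⟨v, rfl⟩ : V)) ⟨(p (cls Γ 𝒢 v) ⟨v, rfl⟩ : V), rfl⟩ : V) = v := by
  refine (perm_apply_cls p⁻¹ _ (p _ ⟨v, rfl⟩)).trans ?_
  exact congrArg Subtype.val ((p (cls Γ 𝒢 v)).symm_apply_apply ⟨v, rfl⟩)

/-- A family of permutations of the equivalence classes, as a graph automorphism. -/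
def permAut (Γ : SimpleGraph V) (𝒢 : Set (Set V)) :
    (∀ c : OrdClass Γ 𝒢, Equiv.Perm (ClassElems Γ 𝒢 c)) →* (Γ ≃g Γ) where
  toFun p :=
    { toFun := fun v => p (cls Γ 𝒢 v) ⟨v, rfl⟩
      invFun := fun v => p⁻¹ (cls Γ 𝒢 v) ⟨v, rfl⟩
      left_inv := perm_inv_apply_cls p
      right_inv := perm_inv_apply_cls p⁻¹
      map_rel_iff' := by
        have key : ∀ (q : ∀ c : OrdClass Γ 𝒢, Equiv.Perm (ClassElems Γ 𝒢 c)) (v w : V),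
            Γ.Adj v w → Γ.Adj (q (cls Γ 𝒢 v) ⟨v, rfl⟩ : V) (q (cls Γ 𝒢 w) ⟨w, rfl⟩ : V) := by
          intro q v w h
          refine adj_of_ordLE h (ordLE_of_cls_eq (q _ ⟨v, rfl⟩).2.symm)
            (ordLE_of_cls_eq (q _ ⟨w, rfl⟩).2.symm) fun heq => h.ne ?_
          rw [← perm_inv_apply_cls q v, ← perm_inv_apply_cls q w]
          exact congrArg (fun u => (q⁻¹ (cls Γ 𝒢 u) ⟨u, rfl⟩ : V)) heq
        intro v w
        refine ⟨fun h => ?_, key p v w⟩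
        have h' := key p⁻¹ _ _ h
        change Γ.Adj (p⁻¹ (cls Γ 𝒢 (p (cls Γ 𝒢 v) ⟨v, rfl⟩ : V)) ⟨_, rfl⟩ : V)
          (p⁻¹ (cls Γ 𝒢 (p (cls Γ 𝒢 w) ⟨w, rfl⟩ : V)) ⟨_, rfl⟩ : V) at h'
        rwa [perm_inv_apply_cls, perm_inv_apply_cls] at h' }
  map_one' := by
    ext v
    rfl
  map_mul' p q := by
    ext v
    exact (perm_apply_cls p (cls Γ 𝒢 v) (q _ ⟨v, rfl⟩)).symm

theorem permAut_apply {𝒢 : Set (Set V)} (p : ∀ c, Equiv.Perm (ClassElems Γ 𝒢 c)) (v : V) :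
    permAut Γ 𝒢 p v = (p (cls Γ 𝒢 v) ⟨v, rfl⟩ : V) := rfl

theorem cls_permAut_apply {𝒢 : Set (Set V)} (p : ∀ c, Equiv.Perm (ClassElems Γ 𝒢 c)) (v : V) :
    cls Γ 𝒢 (permAut Γ 𝒢 p v) = cls Γ 𝒢 v :=
  (p (cls Γ 𝒢 v) ⟨v, rfl⟩).2

theorem permAut_injective (𝒢 : Set (Set V)) : Function.Injective (permAut Γ 𝒢) := by
  intro p q h
  funext c
  ext ⟨v, rfl⟩
  exact DFunLike.congr_fun h v

theorem exists_permAut_eq {𝒢 : Set (Set V)} {σ : Γ ≃g Γ}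
    (h : ∀ v, cls Γ 𝒢 (σ v) = cls Γ 𝒢 v) : ∃ p, permAut Γ 𝒢 p = σ := by
  refine ⟨fun c => Equiv.Perm.subtypePerm σ.toEquiv fun v => ?_, ?_⟩
  · change cls Γ 𝒢 (σ v) = c ↔ _
    rw [h]
  · ext v
    rfl

/-! ### Class permutations lie in the relative group -/

theorem graphOut_permAut_mem_outZero [Finite V] {𝒢 : Set (Set V)}
    (p : ∀ c, Equiv.Perm (ClassElems Γ 𝒢 c)) : graphOut Γ (permAut Γ 𝒢 p) ∈ outZero Γ := by
  classical
  change p ∈ (outZero Γ).comap ((graphOut Γ).comp (permAut Γ 𝒢))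
  -- Membership is a subgroup condition, so it suffices to treat one class at a time and, within it,
  -- a single swap.
  refine Subgroup.pi_mem_of_mulSingle_mem p fun c => ?_
  induction p c using Equiv.Perm.swap_induction_on with
  | one => rw [Pi.mulSingle_one]; exact one_mem _
  | swap_mul f x y hxy ih =>
    rw [Pi.mulSingle_mul]
    refine mul_mem ?_ ih
    have hcls : cls Γ 𝒢 x = cls Γ 𝒢 y := x.2.trans y.2.symm
    have happ : ∀ z : ClassElems Γ 𝒢 c,
        permAut Γ 𝒢 (Pi.mulSingle c (Equiv.swap x y)) z = (Equiv.swap x y z : V) := by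
      intro z
      rw [permAut_apply, perm_apply_cls _ c, Pi.mulSingle_eq_same]
    refine graphOut_swap_mem_outZero (v := x) (w := y) (fun h => hxy (Subtype.ext h)) ?_ ?_ ?_
      (ordLE_of_cls_eq hcls).1 (ordLE_of_cls_eq hcls.symm).1
    · rw [happ, Equiv.swap_apply_left]
    · rw [happ, Equiv.swap_apply_right]
    · intro u hux huy
      by_cases hu : cls Γ 𝒢 u = c
      · rw [happ ⟨u, hu⟩, Equiv.swap_apply_of_ne_of_ne]
        · exact fun h => hux (congrArg Subtype.val h)
        · exact fun h => huy (congrArg Subtype.val h)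
      · rw [permAut_apply, Pi.mulSingle_eq_of_ne hu, Equiv.Perm.one_apply]

theorem graphOut_stabilises {σ : Γ ≃g Γ} {Δ : Set V} (h : ∀ v, σ v ∈ Δ ↔ v ∈ Δ) :
    (graphOut Γ σ).Stabilises (special Γ Δ) := by
  refine ⟨graphAut Γ σ, rfl, ?_⟩
  rw [special, MonoidHom.map_closure]
  congr 1
  ext x
  constructor
  · rintro ⟨_, ⟨v, hv, rfl⟩, rfl⟩
    exact ⟨σ v, (h v).2 hv, (graphAut_gen Γ σ v).symm⟩
  · rintro ⟨v, hv, rfl⟩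
    refine ⟨_, ⟨σ.symm v, (h _).1 (by rwa [σ.apply_symm_apply]), rfl⟩, ?_⟩
    refine (graphAut_gen Γ σ _).trans ?_
    rw [σ.apply_symm_apply]

theorem graphOut_actsTrivially {σ : Γ ≃g Γ} {Δ : Set V} (h : ∀ v ∈ Δ, σ v = v) :
    (graphOut Γ σ).ActsTrivially (special Γ Δ) := by
  refine ⟨graphAut Γ σ, rfl, ?_⟩
  have : Set.EqOn (graphAut Γ σ).toMonoidHom (MonoidHom.id _) (special Γ Δ) := by
    apply MonoidHom.eqOn_closure
    rintro _ ⟨v, hv, rfl⟩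
    refine (graphAut_gen Γ σ v).trans ?_
    rw [h v hv]
    rfl
  exact fun x hx => this hx

/-- When `𝒢` is saturated, the classes of the vertices of members of `ℋ` are singletons. -/
theorem eq_of_mem_of_cls_eq {𝒢 ℋ : Set (Set V)} (hsat : IsSaturated Γ 𝒢 ℋ) {Δ : Set V}
    (hΔ : Δ ∈ ℋ) {v w : V} (hv : v ∈ Δ) (h : cls Γ 𝒢 v = cls Γ 𝒢 w) : w = v := by
  -- An outer automorphism acting trivially on `A_Δ` stabilises `⟨v⟩`, so saturation puts `{v}` in
  -- `𝒢` and nothing else can be equivalent to `v`. Saturation covers proper subgroups only, so a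
  -- one-vertex graph is treated apart.
  by_cases huniv : ({v} : Set V) = Set.univ
  · exact huniv.ge (Set.mem_univ w)
  · have hmem : {v} ∈ 𝒢 := by
      refine hsat {v} huniv fun Φ hΦ => ?_
      obtain ⟨φ, hφ, htriv⟩ := hΦ.1.2 _ ⟨Δ, hΔ, rfl⟩
      refine ⟨φ, hφ, ?_⟩
      have : φ (gen Γ v) = gen Γ v := htriv _ (Subgroup.subset_closure ⟨v, hv, rfl⟩)
      rw [special, Set.image_singleton, MonoidHom.map_closure, Set.image_singleton]
      exact congrArg (fun x => Subgroup.closure {x}) this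
    exact (ordLE_of_cls_eq h).2 _ hmem rfl

theorem graphOut_permAut_mem [Finite V] {𝒢 ℋ : Set (Set V)} (hsat : IsSaturated Γ 𝒢 ℋ)
    (p : ∀ c, Equiv.Perm (ClassElems Γ 𝒢 c)) :
    graphOut Γ (permAut Γ 𝒢 p) ∈ autZero Γ 𝒢 ℋ := by
  refine ⟨⟨_, rfl⟩, ⟨?_, ?_⟩, graphOut_permAut_mem_outZero p⟩
  · rintro _ ⟨Δ, hΔ, rfl⟩
    have hp := cls_permAut_apply (Γ := Γ) p
    exact graphOut_stabilises fun v =>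
      ⟨(ordLE_of_cls_eq (hp v)).2 Δ hΔ, (ordLE_of_cls_eq (hp v).symm).2 Δ hΔ⟩
  · rintro _ ⟨Δ, hΔ, rfl⟩
    exact graphOut_actsTrivially fun v hv =>
      eq_of_mem_of_cls_eq hsat hΔ hv (cls_permAut_apply p v).symm

/-- The isomorphism from the product of the symmetric groups of the classes to `Aut⁰(Γ)`. -/
noncomputable def permEquiv [Finite V] {𝒢 ℋ : Set (Set V)} (hsat : IsSaturated Γ 𝒢 ℋ) :
    (∀ c : OrdClass Γ 𝒢, Equiv.Perm (ClassElems Γ 𝒢 c)) ≃* autZero Γ 𝒢 ℋ :=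
  MulEquiv.ofBijective
    (((graphOut Γ).comp (permAut Γ 𝒢)).codRestrict (autZero Γ 𝒢 ℋ) (graphOut_permAut_mem hsat)) <| by
    constructor
    · intro p q h
      exact permAut_injective 𝒢 (graphOut_injective (congrArg Subtype.val h))
    · rintro ⟨_, ⟨σ, rfl⟩, hσ⟩
      obtain ⟨p, rfl⟩ := exists_permAut_eq (cls_apply_of_graphOut_mem hσ)
      exact ⟨p, rfl⟩

end RAAG

/-! ### Coxeter generators and the rank -/

/-- A finite direct product of symmetric groups of nonempty finite sets is a Coxeter group whose
rank is the sum of the cardinalities minus one. -/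
theorem exists_isCoxeterPair_pi_perm {ι : Type*} [Finite ι] (X : ι → Type*) [∀ i, Finite (X i)]
    [∀ i, Nonempty (X i)] {W : Type*} [Group W] (e : (∀ i, Equiv.Perm (X i)) ≃* W) :
    ∃ S : Set W, S.Finite ∧ S.ncard = ∑ᶠ i, (Nat.card (X i) - 1) ∧ IsCoxeterPair W S := by
  classical
  have := Fintype.ofFinite ι
  choose cs hinj hne using fun i => exists_coxeterSystem_perm (X i)
  obtain ⟨cs', hcs'⟩ := exists_coxeterSystem_pi cs
  have hinj' : Function.Injective (cs'.map e).simple := by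
    rintro ⟨i, b⟩ ⟨j, b'⟩ h
    simp only [CoxeterSystem.map_simple, EmbeddingLike.apply_eq_iff_eq, hcs'] at h
    by_cases hij : i = j
    · subst hij
      rw [hinj i (Pi.mulSingle_injective i h)]
    -- Reflections from different factors could coincide only if both were trivial.
    · have h' := congrFun h i
      rw [Pi.mulSingle_eq_same, Pi.mulSingle_eq_of_ne hij] at h'
      exact (hne i b h').elim
  refine ⟨_, Set.finite_range _, ?_, (cs'.map e).isCoxeterPair_range hinj'⟩
  rw [← Nat.card_coe_set_eq, Nat.card_range_of_injective hinj', Nat.card_sigma,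
    finsum_eq_sum_of_fintype]
  simp

theorem mainTheorem10 {V : Type*} [Finite V] (Γ : SimpleGraph V) (𝒢 ℋ : Set (Set V))
    (hsat : RAAG.IsSaturated Γ 𝒢 ℋ) :
    Function.Injective (RAAG.graphOut Γ) ∧
    (∃ e : (∀ c : RAAG.OrdClass Γ 𝒢, Equiv.Perm (RAAG.ClassElems Γ 𝒢 c)) ≃*
        RAAG.autZero Γ 𝒢 ℋ,
      ∀ p : ∀ c : RAAG.OrdClass Γ 𝒢, Equiv.Perm (RAAG.ClassElems Γ 𝒢 c),
        ∃ σ : Γ ≃g Γ, RAAG.graphOut Γ σ = (e p : OutAut (RAAG Γ)) ∧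
          ∀ v : V, σ v = (p (RAAG.cls Γ 𝒢 v) ⟨v, rfl⟩ : V)) ∧
    ∃ S : Set (RAAG.autZero Γ 𝒢 ℋ),
      S.Finite ∧ S.ncard = RAAG.rank Γ 𝒢 ∧ IsCoxeterPair (RAAG.autZero Γ 𝒢 ℋ) S := by
  refine ⟨RAAG.graphOut_injective, ⟨RAAG.permEquiv hsat, fun p =>
    ⟨RAAG.permAut Γ 𝒢 p, rfl, fun v => rfl⟩⟩, ?_⟩
  -- Classes are nonempty, so the truncated subtraction in the rank is a true one.
  have : ∀ c, Nonempty (RAAG.ClassElems Γ 𝒢 c) := fun c =>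
    let ⟨v, hv⟩ := Quotient.exists_rep c
    ⟨⟨v, hv⟩⟩
  exact exists_isCoxeterPair_pi_perm _ (RAAG.permEquiv hsat)
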